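/- Let $n$ be a positive integer which is not a square, let $(a,b)\in\mathbb Z^2$ be a solution of the Pell equation $x^2-ny^2=1$ with $b\neq 0$, and let $d\geq 0$ be an integer. Let $K=\mathbb Q(\sqrt n)$ with ring of integers $\mathcal O_K$, let $U$ be the subgroup of $\mathcal O_K^\times$ consisting of the units of norm $1$, and let $V(a,b)\subseteq U$ be the subgroup generated by $-1$ and $a+b\sqrt n$; write $(U:V(a,b))$ for its index. The following conditions are equivalent: 1. There exists an integral parametric solution of degree $d$ associated to $(a,b)$, that is, there exist polynomials $P,Q,D\in\mathbb Z[X]$ with $P^2-DQ^2=1$, $\deg D=2$, $P(0)=a$, $Q(0)=b$, $D(0)=n$ and $\deg P=d$. 2. The integer $d$ divides $2(U:V(a,b))$. -/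

import Mathlib

open scoped NumberField

/-- The real quadratic field `ℚ(√n)`, realised as a subfield of `ℝ`
(a quadratic field as soon as `n` is not a square). -/
noncomputable abbrev QSqrt (n : ℕ) : IntermediateField ℚ ℝ :=
  IntermediateField.adjoin ℚ {Real.sqrt (n : ℝ)}

/-- The element `√n` of `ℚ(√n)`. -/
noncomputable def sqrtGen (n : ℕ) : QSqrt n :=
  ⟨Real.sqrt (n : ℝ), IntermediateField.mem_adjoin_simple_self ℚ _⟩

theorem sqrtGen_mul_self (n : ℕ) : sqrtGen n * sqrtGen n = (n : QSqrt n) := by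
  apply Subtype.ext
  simp [sqrtGen]

theorem isIntegral_add_mul_sqrtGen (n : ℕ) (a b : ℤ) :
    IsIntegral ℤ ((a : QSqrt n) + (b : QSqrt n) * sqrtGen n) := by
  have hs : IsIntegral ℤ (sqrtGen n) := by
    apply IsIntegral.of_pow (n := 2) (by norm_num)
    rw [pow_two, sqrtGen_mul_self]
    simpa using isIntegral_algebraMap (R := ℤ) (A := QSqrt n) (x := (n : ℤ))
  have hc (c : ℤ) : IsIntegral ℤ (c : QSqrt n) := by
    simpa using isIntegral_algebraMap (R := ℤ) (A := QSqrt n) (x := c)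
  exact (hc a).add ((hc b).mul hs)

/-- The algebraic integer `a + b√n`, as an element of the ring of integers of `ℚ(√n)`. -/
noncomputable def quadInt (n : ℕ) (a b : ℤ) : 𝓞 (QSqrt n) :=
  ⟨(a : QSqrt n) + (b : QSqrt n) * sqrtGen n, isIntegral_add_mul_sqrtGen n a b⟩

theorem quadInt_mul_conj (n : ℕ) (a b : ℤ) (h : a ^ 2 - (n : ℤ) * b ^ 2 = 1) :
    quadInt n a b * quadInt n a (-b) = 1 := by
  apply NumberField.RingOfIntegers.ext
  have hK : (a : QSqrt n) ^ 2 - (n : QSqrt n) * (b : QSqrt n) ^ 2 = 1 := by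
    exact_mod_cast congrArg (Int.cast : ℤ → QSqrt n) h
  change ((a : QSqrt n) + (b : QSqrt n) * sqrtGen n) *
    ((a : QSqrt n) + ((-b : ℤ) : QSqrt n) * sqrtGen n) = 1
  push_cast
  linear_combination hK - (b : QSqrt n) ^ 2 * sqrtGen_mul_self n

/-- The unit `a + b√n` (with inverse `a - b√n`) of the ring of integers of `ℚ(√n)` attached to a
solution `(a, b)` of the Pell equation `x² - n y² = 1`. -/
noncomputable def pellUnit (n : ℕ) (a b : ℤ) (h : a ^ 2 - (n : ℤ) * b ^ 2 = 1) :
    (𝓞 (QSqrt n))ˣ where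
  val := quadInt n a b
  inv := quadInt n a (-b)
  val_inv := quadInt_mul_conj n a b h
  inv_val := by rw [mul_comm]; exact quadInt_mul_conj n a b h

/-- The group `U` of units of norm `1` of the ring of integers of `ℚ(√n)`. -/
noncomputable def normOneUnits (n : ℕ) : Subgroup (𝓞 (QSqrt n))ˣ where
  carrier := {u | Algebra.norm ℚ ((u : 𝓞 (QSqrt n)) : QSqrt n) = 1}
  one_mem' := by simp
  mul_mem' := by
    intro u v hu hv
    simp only [Set.mem_ofPred_eq] at hu hv ⊢
    simp [hu, hv]
  inv_mem' := by
    intro u hu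
    simp only [Set.mem_ofPred_eq] at hu ⊢
    have h : ((u : 𝓞 (QSqrt n)) : QSqrt n) * (((u⁻¹ : (𝓞 (QSqrt n))ˣ) : 𝓞 (QSqrt n)) : QSqrt n)
        = 1 := by
      rw [← map_mul, Units.mul_inv, map_one]
    have h2 := congrArg (Algebra.norm ℚ) h
    rw [map_mul, hu, one_mul, map_one] at h2
    exact h2

/-- The group `V(a, b)` generated by `-1` and `a + b√n`. -/
noncomputable def pellSubgroup (n : ℕ) (a b : ℤ) (h : a ^ 2 - (n : ℤ) * b ^ 2 = 1) :
    Subgroup (𝓞 (QSqrt n))ˣ :=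
  Subgroup.closure {-1, pellUnit n a b h}

/-- `(P, Q, D)` is an integral parametric solution associated to `(a, b)`: an identity
`P² - D Q² = 1` in `ℤ[X]` with `deg D = 2` that specialises at `X = 0` to `a² - n b² = 1`.
Its degree is `deg P`. -/
structure IsParametricSolution (n : ℕ) (a b : ℤ) (P Q D : Polynomial ℤ) : Prop where
  pell : P ^ 2 - D * Q ^ 2 = 1
  degree_D : D.degree = 2
  eval_P : P.eval 0 = a
  eval_Q : Q.eval 0 = b
  eval_D : D.eval 0 = (n : ℤ)

/-! Write ε = a + b√n. In P² - DQ² = 1 the leading coefficient of D is a rational square s², so D =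
s²X² + βX + n, and D' + 2s√D has constant norm β² - 4s²n. Thus P + Q√D is a rational multiple of (D'
+ 2s√D)^d with d = deg P (`exists_smul_linElt_pow`). At X = 0 this gives ε = c(β + 2s√n)^d.
Conversely such an identity determines D, P, Q over ℚ, and a substitution X ↦ MX makes them
integral. So for d ≥ 1 condition 1 says that ε ∈ ℚ·K^d (`exists_isParametricSolution_iff`).

By an argument in the style of Hilbert 90 this means that ε² = w^d with w of norm 1
(`exists_smul_pow_iff`). Such a w is integral, hence in U (`exists_normOneUnit_pow_eq_iff`). Modulo
±1, U is infinite cyclic, and ε is the k-th power of a generator with |k| = (U:V), so ε² is a d-th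
power exactly when d ∣ 2k (`dvd_two_mul_relIndex_iff`). -/

namespace ParametricPell

open Polynomial

/-! ### Solutions over ℚ[X] as powers of D' + 2s√D -/

/-- Specialisation at `X = 0`, from `ℚ[X][√D]` to `ℚ[√m]` where `m = D(0)`. -/
noncomputable def evalZero {D : ℚ[X]} {m : ℚ} (h : D.eval 0 = m) :
    QuadraticAlgebra ℚ[X] D 0 →+* QuadraticAlgebra ℚ m 0 where
  toFun z := ⟨z.re.eval 0, z.im.eval 0⟩
  map_one' := by ext <;> simp [QuadraticAlgebra.re_one, QuadraticAlgebra.im_one]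
  map_zero' := by ext <;> simp
  map_mul' z w := by ext <;> simp [h]
  map_add' z w := by ext <;> simp

/-- The quadratic polynomial `s²X² + βX + m`. -/
noncomputable def quadPoly (s β m : ℚ) : ℚ[X] := C (s ^ 2) * X ^ 2 + C β * X + C m

/-- The element `D' + 2s√D` of `ℚ[X][√D]`, where `D = s²X² + βX + m`; its norm is constant. -/
noncomputable def linElt (s β m : ℚ) : QuadraticAlgebra ℚ[X] (quadPoly s β m) 0 :=
  ⟨C (2 * s ^ 2) * X + C β, C (2 * s)⟩

theorem quadPoly_eval_zero (s β m : ℚ) : (quadPoly s β m).eval 0 = m := by simp [quadPoly]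

theorem quadPoly_coeff_two (s β m : ℚ) : (quadPoly s β m).coeff 2 = s ^ 2 := by
  simp [quadPoly, -map_pow]

theorem quadPoly_natDegree_le (s β m : ℚ) : (quadPoly s β m).natDegree ≤ 2 := by
  unfold quadPoly; compute_degree

theorem norm_linElt (s β m : ℚ) :
    QuadraticAlgebra.norm (linElt s β m) = C (β ^ 2 - 4 * s ^ 2 * m) := by
  rw [QuadraticAlgebra.norm_def]
  simp only [linElt, quadPoly, map_mul, map_pow, map_sub, map_ofNat]
  ring

theorem norm_linElt_pow (s β m : ℚ) (d : ℕ) :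
    (linElt s β m ^ d).re ^ 2 - quadPoly s β m * (linElt s β m ^ d).im ^ 2 =
      C ((β ^ 2 - 4 * s ^ 2 * m) ^ d) := by
  rw [C_pow, ← norm_linElt, ← map_pow, QuadraticAlgebra.norm_def]
  ring

theorem evalZero_linElt (s β m : ℚ) :
    evalZero (quadPoly_eval_zero s β m) (linElt s β m) = ⟨β, 2 * s⟩ := by
  ext <;> simp [evalZero, linElt]

/-- At infinity √D behaves like sX, so D' + 2s√D grows like 4s²X while its conjugate loses the
leading term. Hence in each power the rational part and sX times the coefficient of √D have the same
leading term. -/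
theorem linElt_pow_leading {s : ℚ} (hs : s ≠ 0) (β m : ℚ) (k : ℕ) :
    (linElt s β m ^ (k + 1)).re.natDegree ≤ k + 1 ∧
      (linElt s β m ^ (k + 1)).im.natDegree ≤ k ∧
      (linElt s β m ^ (k + 1)).re.coeff (k + 1) = s * (linElt s β m ^ (k + 1)).im.coeff k ∧
      (linElt s β m ^ (k + 1)).im.coeff k ≠ 0 := by
  have hL : (C (2 * s ^ 2) * X + C β : ℚ[X]).natDegree ≤ 1 := by compute_degree
  have hL1 : (C (2 * s ^ 2) * X + C β : ℚ[X]).coeff 1 = 2 * s ^ 2 := by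
    simp [coeff_C, -map_pow, -map_mul]
  have hD := quadPoly_natDegree_le s β m
  have hD2 := quadPoly_coeff_two s β m
  induction k with
  | zero =>
    simp only [zero_add, pow_one]
    refine ⟨hL, (natDegree_C _).le, ?_, ?_⟩
    · simp only [linElt, hL1, coeff_C_zero]; ring
    · simpa only [linElt, coeff_C_zero, mul_ne_zero_iff, ne_eq, OfNat.ofNat_ne_zero,
        not_false_eq_true, true_and] using hs
  | succ k ih =>
    obtain ⟨h1, h2, h3, h4⟩ := ih
    rw [pow_succ (linElt s β m) (k + 1)]
    set W := linElt s β m ^ (k + 1)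
    have hre : (W * linElt s β m).re = W.re * (C (2 * s ^ 2) * X + C β) +
        C (2 * s) * (W.im * quadPoly s β m) := by
      simp [linElt]; ring
    have him : (W * linElt s β m).im = C (2 * s) * W.re +
        W.im * (C (2 * s ^ 2) * X + C β) := by
      simp [linElt]; ring
    have e1 := coeff_mul_add_eq_of_natDegree_le h1 hL
    have e2 := coeff_mul_add_eq_of_natDegree_le h2 hD
    have e3 := coeff_mul_add_eq_of_natDegree_le h2 hL
    have c1 : (W * linElt s β m).re.coeff (k + 1 + 1) = 4 * s ^ 3 * W.im.coeff k := by
      rw [hre, coeff_add, coeff_C_mul, e1, hL1, h3, show k + 1 + 1 = k + 2 from rfl, e2, hD2]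
      ring
    have c2 : (W * linElt s β m).im.coeff (k + 1) = 4 * s ^ 2 * W.im.coeff k := by
      rw [him, coeff_add, coeff_C_mul, e3, hL1, h3]
      ring
    refine ⟨?_, ?_, ?_, ?_⟩
    · rw [hre]
      refine natDegree_add_le_of_degree_le (natDegree_mul_le_of_le h1 hL) ?_
      exact (natDegree_C_mul_le _ _).trans ((natDegree_mul_le_of_le h2 hD).trans (by omega))
    · rw [him]
      exact natDegree_add_le_of_degree_le ((natDegree_C_mul_le _ _).trans h1)
        (natDegree_mul_le_of_le h2 hL)
    · rw [c1, c2]; ring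
    · rw [c2]; positivity

theorem eq_C_of_sq_eq_C {f : ℚ[X]} {c : ℚ} (h : f ^ 2 = C c) : f = C (f.coeff 0) := by
  apply eq_C_of_natDegree_eq_zero
  have := congrArg natDegree h
  rw [natDegree_pow, natDegree_C] at this
  omega

/-- A polynomial solution of `P² - DQ² = 1` is a scalar multiple of a power of `D' + 2s√D`. -/
theorem exists_smul_linElt_pow {s β m : ℚ} (hΔ : β ^ 2 - 4 * s ^ 2 * m ≠ 0)
    (hs : s ≠ 0) {P Q : ℚ[X]} {k : ℕ} (hPQ : P ^ 2 - quadPoly s β m * Q ^ 2 = 1)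
    (hP : P.natDegree ≤ k + 1) (hQ : Q.natDegree ≤ k) (hlead : P.coeff (k + 1) = s * Q.coeff k)
    (hQk : Q.coeff k ≠ 0) :
    ∃ c : ℚ, (⟨P, Q⟩ : QuadraticAlgebra ℚ[X] (quadPoly s β m) 0) =
      C c • linElt s β m ^ (k + 1) := by
  obtain ⟨h1, h2, h3, h4⟩ := linElt_pow_leading hs β m k
  have hN := norm_linElt_pow s β m (k + 1)
  set D := quadPoly s β m
  set Δ := (β ^ 2 - 4 * s ^ 2 * m) ^ (k + 1)
  have hΔ' : Δ ≠ 0 := pow_ne_zero _ hΔ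
  set W := linElt s β m ^ (k + 1)
  -- The first factor is the √D-part of (P + Q√D) times the conjugate of W. The product has degree
  -- at most 2k and the second factor at least 2k + 1, its leading terms adding up by `hlead` and
  -- `h3`, so the first factor vanishes.
  have hprod : (Q * W.re - P * W.im) * (Q * W.re + P * W.im) = C Δ * Q ^ 2 - W.im ^ 2 := by
    linear_combination Q ^ 2 * hN - W.im ^ 2 * hPQ
  have hzero : Q * W.re - P * W.im = 0 := by
    by_contra hne
    have hc : (Q * W.re + P * W.im).coeff (k + (k + 1)) ≠ 0 := by
      rw [coeff_add, coeff_mul_add_eq_of_natDegree_le hQ h1, add_comm k (k + 1),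
        coeff_mul_add_eq_of_natDegree_le hP h2, h3, hlead]
      have : Q.coeff k * (s * W.im.coeff k) + s * Q.coeff k * W.im.coeff k =
        2 * (s * (Q.coeff k * W.im.coeff k)) := by ring
      rw [this]
      positivity
    have hd1 := le_natDegree_of_ne_zero hc
    have hne2 : Q * W.re + P * W.im ≠ 0 := fun h => hc (by rw [h, coeff_zero])
    have hd2 := natDegree_mul hne hne2
    have hd3 : (C Δ * Q ^ 2 - W.im ^ 2).natDegree ≤ 2 * k := by
      simpa only [max_self] using natDegree_sub_le_of_le ((natDegree_C_mul_le _ _).trans (natDegree_pow_le_of_le 2 hQ))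
        (natDegree_pow_le_of_le 2 h2)
    rw [hprod] at hd2
    omega
  -- What remains of (P + Q√D) times the conjugate of W is a polynomial with constant square, hence
  -- a constant κ. Dividing by the norm Δ of W gives c = κ/Δ.
  have hsq : (P * W.re - D * Q * W.im) ^ 2 = C Δ := by
    linear_combination D * (Q * W.re - P * W.im) * hzero + (W.re ^ 2 - D * W.im ^ 2) * hPQ + hN
  have hC := eq_C_of_sq_eq_C hsq
  set κ := (P * W.re - D * Q * W.im).coeff 0
  have hΔC : C Δ⁻¹ * C Δ = (1 : ℚ[X]) := by rw [← C_mul, inv_mul_cancel₀ hΔ', C_1]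
  refine ⟨κ * Δ⁻¹, ?_⟩
  ext1
  · simp only [QuadraticAlgebra.re_smul, smul_eq_mul, C_mul]
    linear_combination (-P) * hΔC - C Δ⁻¹ * P * hN + C Δ⁻¹ * W.re * hC +
      C Δ⁻¹ * D * W.im * hzero
  · simp only [QuadraticAlgebra.im_smul, smul_eq_mul, C_mul]
    linear_combination (-Q) * hΔC - C Δ⁻¹ * Q * hN + C Δ⁻¹ * W.im * hC +
      C Δ⁻¹ * W.re * hzero

/-! ### Parametric solutions and d-th powers up to rational factors -/

/-- Rescaling the variable clears all denominators but that of the constant coefficient. -/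
theorem exists_forall_dvd_comp_mem_lifts {f : ℚ[X]} {c : ℤ} (hc : f.eval 0 = c) :
    ∃ N : ℤ, N ≠ 0 ∧ ∀ M : ℤ, N ∣ M →
      ∃ g : ℤ[X], g.map (Int.castRingHom ℚ) = f.comp (C (M : ℚ) * X) := by
  obtain ⟨N, hN, hf⟩ := IsLocalization.integerNormalization_spec (nonZeroDivisors ℤ) f
  refine ⟨N, nonZeroDivisors.ne_zero hN, fun M hM => ?_⟩
  obtain ⟨t, rfl⟩ := hM
  rw [← mem_lifts, lifts_iff_coeff_lifts]
  intro i
  rw [comp_C_mul_X_coeff]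
  rcases i with _ | i
  · exact ⟨c, by simp [← hc, coeff_zero_eq_eval_zero]⟩
  · have h := congrArg (fun p => p.coeff (i + 1)) hf
    simp only [coeff_map, coeff_smul] at h
    refine ⟨(IsLocalization.integerNormalization (nonZeroDivisors ℤ) f).coeff (i + 1) *
      (t * (N * t) ^ i), ?_⟩
    have h' : ((IsLocalization.integerNormalization (nonZeroDivisors ℤ) f).coeff (i + 1) : ℚ) =
      N * f.coeff (i + 1) := by simpa using h
    simp only [eq_intCast]
    push_cast
    rw [h']
    ring

theorem natDegree_eq_of_pell {R : Type*} [CommRing R] [IsDomain R] {P Q D : R[X]}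
    (h : P ^ 2 - D * Q ^ 2 = 1) (hD : D.degree = 2) (hQ : Q ≠ 0) :
    P.natDegree = Q.natDegree + 1 ∧ P.leadingCoeff ^ 2 = D.leadingCoeff * Q.leadingCoeff ^ 2 := by
  have hD0 : D ≠ 0 := by rintro rfl; simp at hD
  have hD2 : D.natDegree = 2 := natDegree_eq_of_degree_eq_some hD
  have hdeg : (D * Q ^ 2).natDegree = 2 + 2 * Q.natDegree := by
    rw [natDegree_mul hD0 (pow_ne_zero 2 hQ), natDegree_pow, hD2]
  have hP : P ^ 2 = D * Q ^ 2 + 1 := by linear_combination h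
  have hlt : (1 : R[X]).degree < (D * Q ^ 2).degree := by
    apply degree_lt_degree
    rw [hdeg, natDegree_one]
    omega
  constructor
  · have h2 : (P ^ 2).natDegree = (D * Q ^ 2).natDegree := by
      rw [hP]; exact natDegree_add_eq_left_of_degree_lt hlt
    rw [natDegree_pow, hdeg] at h2
    omega
  · have h2 : (P ^ 2).leadingCoeff = (D * Q ^ 2).leadingCoeff := by
      rw [hP]; exact leadingCoeff_add_of_degree_lt' hlt
    simpa [leadingCoeff_mul, leadingCoeff_pow] using h2

theorem sq_ne_natCast_of_not_isSquare {n : ℕ} (hsq : ¬ IsSquare n) (r : ℚ) : r ^ 2 ≠ n := by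
  intro h
  apply hsq
  rw [← Rat.isSquare_natCast_iff]
  exact ⟨r, by rw [← h, sq]⟩

theorem exists_smul_pow_of_isParametricSolution {n : ℕ} (hsq : ¬ IsSquare n) {a b : ℤ} (hb : b ≠ 0)
    {P Q D : ℤ[X]} (h : IsParametricSolution n a b P Q D) :
    P.natDegree ≠ 0 ∧ ∃ (c : ℚ) (z : QuadraticAlgebra ℚ (n : ℚ) 0), c • z ^ P.natDegree = ⟨a, b⟩ := by
  have hQ : Q ≠ 0 := by
    rintro rfl
    exact hb (by simpa using h.eval_Q.symm)
  obtain ⟨hdeg, hlead⟩ := natDegree_eq_of_pell h.pell h.degree_D hQ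
  have hD2 : D.natDegree = 2 := natDegree_eq_of_degree_eq_some h.degree_D
  have hqZ : Q.leadingCoeff ≠ 0 := leadingCoeff_ne_zero.2 hQ
  have hpZ : P.leadingCoeff ≠ 0 := leadingCoeff_ne_zero.2 (by rintro rfl; simp at hdeg)
  have hp : (P.leadingCoeff : ℚ) ≠ 0 := by exact_mod_cast hpZ
  have hq : (Q.leadingCoeff : ℚ) ≠ 0 := by exact_mod_cast hqZ
  -- Of the two square roots of the leading coefficient of D, this is the one for which P and sXQ
  -- have the same leading coefficient, not opposite ones.
  obtain ⟨s, hs⟩ : ∃ s : ℚ, s = P.leadingCoeff / Q.leadingCoeff := ⟨_, rfl⟩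
  have hs0 : s ≠ 0 := by rw [hs]; positivity
  have hsA : s ^ 2 = (D.coeff 2 : ℚ) := by
    have : (P.leadingCoeff : ℚ) ^ 2 = D.leadingCoeff * (Q.leadingCoeff : ℚ) ^ 2 := by
      exact_mod_cast hlead
    rw [hs, div_pow, this, ← hD2, coeff_natDegree]
    field_simp
  have hinj : Function.Injective (Int.castRingHom ℚ) := Int.cast_injective
  have hDmap : D.map (Int.castRingHom ℚ) = quadPoly s (D.coeff 1) n := by
    have h0 : D.coeff 0 = n := by rw [coeff_zero_eq_eval_zero, h.eval_D]
    rw [quadPoly, hsA]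
    conv_lhs => rw [eq_quadratic_of_degree_le_two h.degree_D.le]
    simp [h0]
  obtain ⟨k, hk⟩ : ∃ k, Q.natDegree = k := ⟨_, rfl⟩
  rw [hk] at hdeg
  obtain ⟨c, hc⟩ := exists_smul_linElt_pow (s := s) (β := D.coeff 1) (m := n) (k := k)
    (P := P.map (Int.castRingHom ℚ)) (Q := Q.map (Int.castRingHom ℚ)) (by
      -- A vanishing discriminant would make n the square of β/(2s).
      intro h0
      apply sq_ne_natCast_of_not_isSquare hsq (D.coeff 1 / (2 * s))
      field_simp
      linear_combination h0) hs0
    (by simpa [hDmap] using congrArg (map (Int.castRingHom ℚ)) h.pell)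
    (by rw [natDegree_map_eq_of_injective hinj, hdeg])
    (by rw [natDegree_map_eq_of_injective hinj, hk])
    (by
      rw [coeff_map, coeff_map, ← hdeg, ← hk, coeff_natDegree, coeff_natDegree, hs]
      simp [hq])
    (by rw [coeff_map, ← hk, coeff_natDegree]; exact hq)
  refine ⟨by omega, c, ⟨D.coeff 1, 2 * s⟩, ?_⟩
  have := congrArg (evalZero (quadPoly_eval_zero s (D.coeff 1) n)) hc
  rw [← QuadraticAlgebra.C_mul_eq_smul, map_mul, map_pow, evalZero_linElt] at this
  rw [hdeg, ← QuadraticAlgebra.C_mul_eq_smul]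
  have hR : ∀ p : ℤ[X], (p.map (Int.castRingHom ℚ)).eval 0 = ((p.eval 0 : ℤ) : ℚ) := by
    intro p
    simp
  have hl : evalZero (quadPoly_eval_zero s (D.coeff 1) n)
      ⟨P.map (Int.castRingHom ℚ), Q.map (Int.castRingHom ℚ)⟩ = ⟨a, b⟩ := by
    ext
    · simp only [evalZero, RingHom.coe_mk, MonoidHom.coe_mk, OneHom.coe_mk, hR, h.eval_P]
    · simp only [evalZero, RingHom.coe_mk, MonoidHom.coe_mk, OneHom.coe_mk, hR, h.eval_Q]
  have hr : evalZero (quadPoly_eval_zero s (D.coeff 1) n) (QuadraticAlgebra.C (C c)) =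
      QuadraticAlgebra.C c := by
    ext <;> simp [evalZero]
  rw [← hl, this, hr]

theorem exists_isParametricSolution_of_smul_pow {n : ℕ} {a b : ℤ}
    (hab : a ^ 2 - (n : ℤ) * b ^ 2 = 1) (hb : b ≠ 0) {k : ℕ} {c : ℚ}
    {z : QuadraticAlgebra ℚ (n : ℚ) 0} (hz : c • z ^ (k + 1) = ⟨a, b⟩) :
    ∃ P Q D : ℤ[X], IsParametricSolution n a b P Q D ∧ P.degree = (k + 1 : ℕ) := by
  have hbQ : (b : ℚ) ≠ 0 := by exact_mod_cast hb
  have hc0 : c ≠ 0 := by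
    rintro rfl
    rw [zero_smul] at hz
    exact hbQ (congrArg QuadraticAlgebra.im hz).symm
  -- Reading z as the value of D' + 2s√D at X = 0 dictates the choice of D.
  obtain ⟨s, β, rfl⟩ : ∃ s β : ℚ, z = ⟨β, 2 * s⟩ := ⟨z.im / 2, z.re, by ext <;> simp; ring⟩
  have hs : s ≠ 0 := by
    rintro rfl
    have h1 : (⟨β, 2 * 0⟩ : QuadraticAlgebra ℚ (n : ℚ) 0) = QuadraticAlgebra.C β := by
      ext <;> simp
    rw [h1, QuadraticAlgebra.C_eq_algebraMap, ← map_pow] at hz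
    have := congrArg QuadraticAlgebra.im hz
    rw [QuadraticAlgebra.im_smul, QuadraticAlgebra.algebraMap_im, smul_zero] at this
    exact hbQ this.symm
  have hnorm : c ^ 2 * (β ^ 2 - 4 * s ^ 2 * n) ^ (k + 1) = 1 := by
    have h1 := congrArg QuadraticAlgebra.norm hz
    rw [← QuadraticAlgebra.C_mul_eq_smul, map_mul, map_pow] at h1
    simp only [QuadraticAlgebra.norm_def, QuadraticAlgebra.re_C, QuadraticAlgebra.im_C] at h1
    have h2 : (a : ℚ) ^ 2 - n * b ^ 2 = 1 := by exact_mod_cast hab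
    have h3 : β ^ 2 - 4 * s ^ 2 * n = β * β + 0 * β * (2 * s) - n * (2 * s) * (2 * s) := by ring
    rw [h3]
    linear_combination h1 + h2
  obtain ⟨g1, g2, g3, g4⟩ := linElt_pow_leading hs β n k
  have hN := norm_linElt_pow s β n (k + 1)
  have hev : evalZero (quadPoly_eval_zero s β n) (linElt s β n ^ (k + 1)) = ⟨β, 2 * s⟩ ^ (k + 1) := by
    rw [map_pow, evalZero_linElt]
  rw [← hev] at hz
  set W := linElt s β n ^ (k + 1)
  have hre : (C c * W.re).eval 0 = a := by
    simpa [evalZero] using congrArg QuadraticAlgebra.re hz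
  have him : (C c * W.im).eval 0 = b := by
    simpa [evalZero] using congrArg QuadraticAlgebra.im hz
  have hD0 : (quadPoly s β n).eval 0 = ((n : ℤ) : ℚ) := by simp [quadPoly_eval_zero]
  obtain ⟨N₁, hN₁, h1⟩ := exists_forall_dvd_comp_mem_lifts hre
  obtain ⟨N₂, hN₂, h2⟩ := exists_forall_dvd_comp_mem_lifts him
  obtain ⟨N₃, hN₃, h3⟩ := exists_forall_dvd_comp_mem_lifts hD0
  obtain ⟨M, hM⟩ : ∃ M, M = N₁ * N₂ * N₃ := ⟨_, rfl⟩
  have hM0 : (M : ℚ) ≠ 0 := by rw [hM]; push_cast; positivity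
  obtain ⟨P, hP⟩ := h1 M ⟨N₂ * N₃, by rw [hM]; ring⟩
  obtain ⟨Q, hQ⟩ := h2 M ⟨N₁ * N₃, by rw [hM]; ring⟩
  obtain ⟨D, hD⟩ := h3 M ⟨N₁ * N₂, by rw [hM]; ring⟩
  have hinj : Function.Injective (Int.castRingHom ℚ) := Int.cast_injective
  have hlin : (C (M : ℚ) * X).natDegree = 1 := natDegree_C_mul_X _ hM0
  have hR : ∀ p : ℤ[X], (p.map (Int.castRingHom ℚ)).eval 0 = ((p.eval 0 : ℤ) : ℚ) := by
    intro p
    simp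
  have hcomp : ∀ p : ℚ[X], (p.comp (C (M : ℚ) * X)).eval 0 = p.eval 0 := by
    intro p; simp [eval_comp]
  refine ⟨P, Q, D, ⟨?_, ?_, ?_, ?_, ?_⟩, ?_⟩
  · apply map_injective _ hinj
    rw [Polynomial.map_sub, Polynomial.map_mul, Polynomial.map_pow, Polynomial.map_pow,
      Polynomial.map_one, hP, hQ, hD, ← pow_comp, ← pow_comp, ← mul_comp, ← sub_comp]
    have : (C c * W.re) ^ 2 - quadPoly s β n * (C c * W.im) ^ 2 = 1 := by
      have hc' : C (c ^ 2) * C ((β ^ 2 - 4 * s ^ 2 * n) ^ (k + 1)) = (1 : ℚ[X]) := by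
        rw [← C_mul, hnorm, C_1]
      rw [Polynomial.C_pow (a := c)] at hc'
      linear_combination C c ^ 2 * hN + hc'
    rw [this, one_comp]
  · rw [← degree_map_eq_of_injective hinj, hD, ← Nat.cast_two, degree_eq_iff_natDegree_eq_of_pos two_pos,
      natDegree_comp, hlin, mul_one]
    refine natDegree_eq_of_le_of_coeff_ne_zero (quadPoly_natDegree_le _ _ _) ?_
    rw [quadPoly_coeff_two]
    positivity
  · have := hR P
    rw [hP, hcomp, hre] at this
    exact_mod_cast this.symm
  · have := hR Q
    rw [hQ, hcomp, him] at this
    exact_mod_cast this.symm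
  · have := hR D
    rw [hD, hcomp, hD0] at this
    exact_mod_cast this.symm
  · rw [← degree_map_eq_of_injective hinj, hP, degree_eq_iff_natDegree_eq_of_pos (Nat.succ_pos k),
      natDegree_comp, hlin, mul_one]
    refine natDegree_eq_of_le_of_coeff_ne_zero ((natDegree_C_mul_le _ _).trans g1) ?_
    rw [coeff_C_mul, g3]
    positivity

/-- A parametric solution of degree `d ≥ 1` exists if and only if `a + b√n` is a rational multiple
of a `d`-th power in `ℚ(√n)`. -/
theorem exists_isParametricSolution_iff {n : ℕ} (hsq : ¬ IsSquare n) {a b : ℤ}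
    (hab : a ^ 2 - (n : ℤ) * b ^ 2 = 1) (hb : b ≠ 0) (d : ℕ) :
    (∃ P Q D : ℤ[X], IsParametricSolution n a b P Q D ∧ P.degree = d) ↔
      d ≠ 0 ∧ ∃ (c : ℚ) (z : QuadraticAlgebra ℚ (n : ℚ) 0), c • z ^ d = ⟨a, b⟩ := by
  constructor
  · rintro ⟨P, Q, D, h, hd⟩
    obtain rfl := natDegree_eq_of_degree_eq_some hd
    exact exists_smul_pow_of_isParametricSolution hsq hb h
  · rintro ⟨hd, c, z, hz⟩
    obtain ⟨k, rfl⟩ := Nat.exists_eq_succ_of_ne_zero hd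
    exact exists_isParametricSolution_of_smul_pow hab hb hz

/-! ### From rational multiples of d-th powers to d-th powers of norm one -/

/-- An element `ε` of norm one is a scalar multiple of a `d`-th power exactly when `ε²` is the
`d`-th power of an element of norm one. -/
theorem exists_smul_pow_iff {q : ℚ} (hq : ∀ r : ℚ, r ^ 2 ≠ q) {ε : QuadraticAlgebra ℚ q 0}
    (hε : ε.norm = 1) (hε2 : ε ^ 2 ≠ 1) (d : ℕ) :
    (∃ (c : ℚ) (z : QuadraticAlgebra ℚ q 0), c • z ^ d = ε) ↔
      ∃ w : QuadraticAlgebra ℚ q 0, w.norm = 1 ∧ w ^ d = ε ^ 2 := by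
  have : Fact (∀ r : ℚ, r ^ 2 ≠ q + 0 * r) := ⟨fun r => by simpa using hq r⟩
  have hN : ∀ z : QuadraticAlgebra ℚ q 0, algebraMap ℚ (QuadraticAlgebra ℚ q 0) z.norm = z * star z := fun z =>
    QuadraticAlgebra.algebraMap_norm_eq_mul_star z
  have hNC : ∀ c : ℚ, QuadraticAlgebra.norm (algebraMap ℚ (QuadraticAlgebra ℚ q 0) c) = c ^ 2 :=
    fun c => QuadraticAlgebra.norm_algebraMap c
  simp only [Algebra.smul_def]
  constructor
  · rintro ⟨c, z, hz⟩
    have hn : c ^ 2 * z.norm ^ d = 1 := by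
      rw [← hε, ← hz, map_mul, map_pow, hNC]
    rcases Nat.eq_zero_or_pos d with rfl | hd
    · exfalso
      apply hε2
      rw [pow_zero, mul_one] at hn
      rw [← hz, pow_zero, mul_one, ← map_pow, hn, map_one]
    have hz0 : z.norm ≠ 0 := by
      intro h0
      rw [h0, zero_pow hd.ne', mul_zero] at hn
      exact zero_ne_one hn
    -- This is z divided by its conjugate.
    refine ⟨algebraMap ℚ (QuadraticAlgebra ℚ q 0) z.norm⁻¹ * z ^ 2, ?_, ?_⟩
    · rw [map_mul, map_pow, hNC]
      field_simp
    · have h2 : (z.norm⁻¹) ^ d = c ^ 2 := by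
        rw [inv_pow]
        exact inv_eq_of_mul_eq_one_left hn
      rw [mul_pow, ← map_pow, h2, ← hz, map_pow]
      ring
  · rintro ⟨w, hw, hwd⟩
    rcases Nat.even_or_odd' d with ⟨j, rfl | rfl⟩
    · have hws : w * star w = 1 := by rw [← hN, hw, map_one]
      have hw1 : 1 + w ≠ 0 := by
        intro h
        apply hε2
        rw [← hwd, show w = -1 by linear_combination h]
        simp
      have hn0 : (1 + w).norm ≠ 0 := by rwa [Ne, QuadraticAlgebra.norm_eq_zero_iff_eq_zero]
      -- Hilbert 90 made explicit: 1 + w is a square root of w up to a rational factor, so its 2j-th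
      -- power is a rational multiple of w^j = ±ε.
      have hsq : (1 + w) ^ 2 = algebraMap ℚ (QuadraticAlgebra ℚ q 0) (1 + w).norm * w := by
        rw [hN, star_add, star_one]
        linear_combination (-1 - w) * hws
      have hCi : algebraMap ℚ (QuadraticAlgebra ℚ q 0) ((1 + w).norm⁻¹ ^ j) * algebraMap ℚ (QuadraticAlgebra ℚ q 0) (1 + w).norm ^ j =
          (1 : QuadraticAlgebra ℚ q 0) := by
        rw [map_pow, ← mul_pow, ← map_mul, inv_mul_cancel₀ hn0, map_one, one_pow]
      have hwj : w ^ j = ε ∨ w ^ j = -ε := by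
        apply sq_eq_sq_iff_eq_or_eq_neg.1
        rw [← hwd]; ring
      have hmain : algebraMap ℚ (QuadraticAlgebra ℚ q 0) ((1 + w).norm⁻¹ ^ j) * (1 + w) ^ (2 * j) = w ^ j := by
        rw [pow_mul, hsq, mul_pow, ← mul_assoc, hCi, one_mul]
      rcases hwj with h | h
      · exact ⟨_, _, hmain.trans h⟩
      · refine ⟨-((1 + w).norm⁻¹ ^ j), 1 + w, ?_⟩
        rw [map_neg, neg_mul, hmain, h, neg_neg]
    · have hws : w * star w = 1 := by rw [← hN, hw, map_one]
      have hwj : w ^ j * star w ^ j = 1 := by rw [← mul_pow, hws, one_pow]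
      -- For odd d, z = εw⁻ʲ satisfies z² = w, whence z^d = zwʲ = ε with no rational factor.
      refine ⟨1, ε * star w ^ j, ?_⟩
      have hz2 : (ε * star w ^ j) ^ 2 = w := by
        calc (ε * star w ^ j) ^ 2 = w ^ (2 * j + 1) * (star w ^ j) ^ 2 := by rw [hwd]; ring
          _ = w * (w ^ j * star w ^ j) ^ 2 := by ring
          _ = w := by rw [hwj]; ring
      rw [map_one, one_mul, pow_succ, pow_mul, hz2]
      linear_combination ε * hwj

/-! ### Indices in infinite cyclic groups -/

theorem relIndex_zpowers_zpow {G : Type*} [Group G] {g : G}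
    (hg : Function.Injective fun i : ℤ => g ^ i) (k : ℤ) :
    (Subgroup.zpowers (g ^ k)).relIndex (Subgroup.zpowers g) = k.natAbs := by
  have hinj : Function.Injective (zpowersHom G g) := fun i j h => by
    simp only [zpowersHom_apply] at h
    exact Multiplicative.toAdd.injective (hg h)
  have h1 : Subgroup.zpowers g = (⊤ : Subgroup (Multiplicative ℤ)).map (zpowersHom G g) := by
    ext x; simp [Subgroup.mem_zpowers_iff]
  have h2 : Subgroup.zpowers (g ^ k) =
      (Subgroup.zpowers (Multiplicative.ofAdd k)).map (zpowersHom G g) := by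
    rw [MonoidHom.map_zpowers, zpowersHom_apply, toAdd_ofAdd]
  rw [h1, h2, Subgroup.relIndex_map_map_of_injective _ _ hinj, Subgroup.relIndex_top_right]
  exact Int.index_zmultiples k

/-- As U and V contain the kernel, the index can be computed on their images. These lie in the
torsion-free group ℝ and are generated by g and gᵏ, so the index is |k|, and the right side asks for
j with jd = 2k. -/
theorem dvd_two_mul_relIndex_iff {G : Type*} [Group G] (f : G →* Multiplicative ℝ)
    {U V : Subgroup G} {g : Multiplicative ℝ} {ε : G} (hU : U.map f = Subgroup.zpowers g)
    (hV : V.map f = Subgroup.zpowers (f ε)) (hkV : f.ker ≤ V) (hkU : f.ker ≤ U) (hεU : ε ∈ U)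
    (hε : f ε ≠ 1) (d : ℕ) :
    d ∣ 2 * V.relIndex U ↔ ∃ u ∈ U, f u ^ d = f ε ^ 2 := by
  have hrel := Subgroup.relIndex_map_map f V U
  rw [sup_eq_left.2 hkV, sup_eq_left.2 hkU, hU, hV] at hrel
  obtain ⟨k, hk⟩ : ∃ k : ℤ, g ^ k = f ε := by
    rw [← Subgroup.mem_zpowers_iff, ← hU]
    exact Subgroup.mem_map_of_mem f hεU
  have hg1 : g ≠ 1 := by
    rintro rfl
    exact hε (by rw [← hk, one_zpow])
  have hginj : Function.Injective fun i : ℤ => g ^ i := by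
    intro i j h
    have h' : (i : ℝ) * g.toAdd = (j : ℝ) * g.toAdd := by
      have := congrArg Multiplicative.toAdd h
      simpa using this
    exact_mod_cast mul_right_cancel₀ (show g.toAdd ≠ 0 from hg1) h'
  rw [← hk, relIndex_zpowers_zpow hginj] at hrel
  rw [← hrel, ← hk]
  have hdvd : d ∣ 2 * k.natAbs ↔ (d : ℤ) ∣ 2 * k := by
    rw [Int.natCast_dvd, Int.natAbs_mul]; rfl
  rw [hdvd]
  constructor
  · rintro ⟨j, hj⟩
    obtain ⟨u, hu, huj⟩ : g ^ j ∈ U.map f := by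
      rw [hU]; exact Subgroup.zpow_mem_zpowers g j
    refine ⟨u, hu, ?_⟩
    rw [huj, ← zpow_natCast, ← zpow_natCast, ← zpow_mul, ← zpow_mul]
    congr 1
    push_cast
    linarith
  · rintro ⟨u, hu, hud⟩
    obtain ⟨j, hj⟩ : ∃ j : ℤ, g ^ j = f u := by
      rw [← Subgroup.mem_zpowers_iff, ← hU]
      exact Subgroup.mem_map_of_mem f hu
    refine ⟨j, ?_⟩
    rw [← hj, ← zpow_natCast, ← zpow_natCast, ← zpow_mul, ← zpow_mul] at hud
    have := hginj hud
    push_cast at this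
    linarith

/-! ### The units of norm one -/

section

variable (n : ℕ)

/-- The map `ℚ[√n] → ℚ(√n) ⊆ ℝ`. -/
noncomputable def toField : QuadraticAlgebra ℚ (n : ℚ) 0 →ₐ[ℚ] QSqrt n :=
  QuadraticAlgebra.lift ⟨sqrtGen n, by
    rw [sqrtGen_mul_self, zero_smul, add_zero, Algebra.smul_def, mul_one, map_natCast]⟩

theorem toField_apply (z : QuadraticAlgebra ℚ (n : ℚ) 0) :
    toField n z = algebraMap ℚ (QSqrt n) z.re + algebraMap ℚ (QSqrt n) z.im * sqrtGen n := by
  simp [toField, QuadraticAlgebra.lift, Algebra.smul_def]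

variable {n}

theorem toField_bijective (hsq : ¬ IsSquare n) : Function.Bijective (toField n) := by
  have : Fact (∀ r : ℚ, r ^ 2 ≠ (n : ℚ) + 0 * r) :=
    ⟨fun r => by simpa using sq_ne_natCast_of_not_isSquare hsq r⟩
  refine ⟨(toField n).toRingHom.injective, fun x => ?_⟩
  have hle : QSqrt n ≤ ((QSqrt n).val.comp (toField n)).fieldRange := by
    rw [IntermediateField.adjoin_simple_le_iff]
    refine ⟨QuadraticAlgebra.omega, ?_⟩
    change ((toField n QuadraticAlgebra.omega : QSqrt n) : ℝ) = _
    simp [toField_apply, sqrtGen]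
  obtain ⟨z, hz⟩ := hle x.2
  exact ⟨z, Subtype.ext hz⟩

theorem norm_toField (hsq : ¬ IsSquare n) (z : QuadraticAlgebra ℚ (n : ℚ) 0) :
    Algebra.norm ℚ (toField n z) = z.norm := by
  have h := Algebra.norm_eq_of_algEquiv (AlgEquiv.ofBijective _ (toField_bijective hsq)) z
  rw [AlgEquiv.coe_ofBijective] at h
  rw [h, Algebra.norm_apply, ← QuadraticAlgebra.det_toLinearMap_eq_norm]
  rfl

/-- The real embedding of the ring of integers of `ℚ(√n)`. -/
noncomputable def realEmb (n : ℕ) : 𝓞 (QSqrt n) →+* ℝ :=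
  (QSqrt n).val.toRingHom.comp (algebraMap (𝓞 (QSqrt n)) (QSqrt n))

theorem realEmb_injective : Function.Injective (realEmb n) :=
  (QSqrt n).val.toRingHom.injective.comp NumberField.RingOfIntegers.coe_injective

theorem realEmb_unit_ne_zero (u : (𝓞 (QSqrt n))ˣ) : realEmb n u ≠ 0 :=
  (u.isUnit.map (realEmb n)).ne_zero

/-- The logarithm of the absolute value of a unit in the real embedding. -/
noncomputable def logEmb (n : ℕ) : (𝓞 (QSqrt n))ˣ →* Multiplicative ℝ where
  -- `Real.log x` is log |x| for negative x too, so the kernel is {1, -1}.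
  toFun u := Multiplicative.ofAdd (Real.log (realEmb n u))
  map_one' := by simp
  map_mul' u v := by
    rw [Units.val_mul, map_mul, Real.log_mul (realEmb_unit_ne_zero u) (realEmb_unit_ne_zero v)]
    rfl

theorem logEmb_eq_one_iff {u : (𝓞 (QSqrt n))ˣ} : logEmb n u = 1 ↔ u = 1 ∨ u = -1 := by
  have h : logEmb n u = 1 ↔ Real.log (realEmb n u) = 0 := Iff.rfl
  rw [h, Real.log_eq_zero]
  constructor
  · rintro (h | h | h)
    · exact absurd h (realEmb_unit_ne_zero u)
    · left
      apply Units.ext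
      apply realEmb_injective
      rw [h]; simp
    · right
      apply Units.ext
      apply realEmb_injective
      rw [h]; simp
  · rintro (rfl | rfl) <;> simp

/-- For norm one the inverse is the conjugate, so the sum is the trace: rational and integral. -/
theorem exists_int_eq_realEmb_add_inv (hsq : ¬ IsSquare n) {u : (𝓞 (QSqrt n))ˣ}
    (hu : u ∈ normOneUnits n) :
    ∃ t : ℤ, realEmb n u + (realEmb n u)⁻¹ = t := by
  obtain ⟨z, hz⟩ := (toField_bijective hsq).2 (u : 𝓞 (QSqrt n))
  have hN : z.norm = 1 := by rw [← norm_toField hsq, hz]; exact hu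
  have hmul : toField n z * toField n (star z) = 1 := by
    rw [← map_mul, ← QuadraticAlgebra.algebraMap_norm_eq_mul_star, hN, map_one, map_one]
  have hu1 : ((u : 𝓞 (QSqrt n)) : QSqrt n) * (((u⁻¹ : (𝓞 (QSqrt n))ˣ) : 𝓞 (QSqrt n)) : QSqrt n)
        = 1 := by
    rw [← map_mul, Units.mul_inv, map_one]
  have hinv : (((u⁻¹ : (𝓞 (QSqrt n))ˣ) : 𝓞 (QSqrt n)) : QSqrt n) = toField n (star z) := by
    rw [← hz] at hu1
    exact mul_left_cancel₀ (left_ne_zero_of_mul_eq_one hmul) (hu1.trans hmul.symm)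
  have hsum : z + star z = algebraMap ℚ _ (2 * z.re) := by
    ext
    · simp; ring
    · simp
  have hint : IsIntegral ℤ (algebraMap ℚ (QSqrt n) (2 * z.re)) := by
    rw [← (toField n).commutes, ← hsum, map_add, hz, ← hinv]
    exact (NumberField.RingOfIntegers.isIntegral_coe _).add
      (NumberField.RingOfIntegers.isIntegral_coe _)
  rw [isIntegral_algebraMap_iff (algebraMap ℚ (QSqrt n)).injective,
    IsIntegrallyClosed.isIntegral_iff] at hint
  obtain ⟨t, ht⟩ := hint
  refine ⟨t, ?_⟩
  have h1 : (realEmb n u)⁻¹ = realEmb n (u⁻¹ : (𝓞 (QSqrt n))ˣ) := by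
    apply inv_eq_of_mul_eq_one_right
    rw [← map_mul, Units.mul_inv, map_one]
  have h2 : realEmb n u + realEmb n (u⁻¹ : (𝓞 (QSqrt n))ˣ) =
      (toField n z + toField n (star z) : QSqrt n) := by
    rw [hz, ← hinv]; rfl
  rw [h1, h2, ← map_add, hsum, AlgHom.commutes, ← ht]
  simp

/-- The image is discrete: a unit x with 1 < |x| < 2 would have 2 < |x + x⁻¹| < 3, yet x + x⁻¹ is an
integer. -/
theorem exists_map_logEmb_eq_zpowers (hsq : ¬ IsSquare n) :
    ∃ g, (normOneUnits n).map (logEmb n) = Subgroup.zpowers g := by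
  simp only [Subgroup.zpowers_eq_closure]
  refine Subgroup.cyclic_of_isolated_one (a := Multiplicative.ofAdd (Real.log 2))
    (show (0 : ℝ) < Real.log 2 from Real.log_pos one_lt_two) ?_
  rw [Set.disjoint_left]
  rintro _ ⟨u, hu, rfl⟩ ⟨h1, h2⟩
  replace h1 : 0 < Real.log (realEmb n u) := h1
  replace h2 : Real.log (realEmb n u) < Real.log 2 := h2
  obtain ⟨t, ht⟩ := exists_int_eq_realEmb_add_inv hsq hu
  have hx0 := realEmb_unit_ne_zero u
  set x := realEmb n u
  rw [← Real.log_abs] at h1 h2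
  have hpos : 0 < |x| := abs_pos.2 hx0
  have h1' : 1 < |x| := (Real.log_pos_iff hpos.le).1 h1
  have h2' : |x| < 2 := (Real.log_lt_log_iff hpos two_pos).1 h2
  have hxx : x * (t - x) = 1 := by rw [← ht]; field_simp; ring
  have ha : 2 < |t| ∧ |t| < 3 := by
    rw [← Int.cast_lt (R := ℝ), ← Int.cast_lt (R := ℝ), Int.cast_abs]
    push_cast
    rcases abs_cases x with ⟨hx, hx'⟩ | ⟨hx, hx'⟩ <;> rw [hx] at h1' h2'
    · have : (2 : ℝ) < t ∧ (t : ℝ) < 3 := by constructor <;> nlinarith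
      rw [abs_of_pos (by linarith)]; exact this
    · have : (t : ℝ) < -2 ∧ -3 < (t : ℝ) := by constructor <;> nlinarith
      rw [abs_of_neg (by linarith)]; constructor <;> linarith
  omega

theorem neg_one_mem_normOneUnits (hsq : ¬ IsSquare n) : -1 ∈ normOneUnits n := by
  change Algebra.norm ℚ (((-1 : (𝓞 (QSqrt n))ˣ) : 𝓞 (QSqrt n)) : QSqrt n) = 1
  have : (((-1 : (𝓞 (QSqrt n))ˣ) : 𝓞 (QSqrt n)) : QSqrt n) = toField n (-1) := by simp
  rw [this, norm_toField hsq, QuadraticAlgebra.norm_neg, map_one]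

theorem coe_pellUnit {a b : ℤ} (hab : a ^ 2 - (n : ℤ) * b ^ 2 = 1) :
    ((pellUnit n a b hab : 𝓞 (QSqrt n)) : QSqrt n) = toField n ⟨a, b⟩ := by
  rw [toField_apply]
  simp only [map_intCast]
  rfl

theorem norm_pell {a b : ℤ} (hab : a ^ 2 - (n : ℤ) * b ^ 2 = 1) :
    QuadraticAlgebra.norm (⟨a, b⟩ : QuadraticAlgebra ℚ (n : ℚ) 0) = 1 := by
  have h2 : (a : ℚ) ^ 2 - n * b ^ 2 = 1 := by exact_mod_cast hab
  rw [QuadraticAlgebra.norm_def]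
  linear_combination h2

theorem pellUnit_mem_normOneUnits (hsq : ¬ IsSquare n) {a b : ℤ}
    (hab : a ^ 2 - (n : ℤ) * b ^ 2 = 1) : pellUnit n a b hab ∈ normOneUnits n := by
  change Algebra.norm ℚ ((pellUnit n a b hab : 𝓞 (QSqrt n)) : QSqrt n) = 1
  rw [coe_pellUnit, norm_toField hsq, norm_pell hab]

/-- Ensures that ε ≠ ±1, so that its logarithm is nonzero, and disposes of d = 0. -/
theorem pell_sq_ne_one {a b : ℤ} (hab : a ^ 2 - (n : ℤ) * b ^ 2 = 1) (hb : b ≠ 0) :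
    (⟨a, b⟩ : QuadraticAlgebra ℚ (n : ℚ) 0) ^ 2 ≠ 1 := by
  intro h
  have him := congrArg QuadraticAlgebra.im h
  have hre := congrArg QuadraticAlgebra.re h
  simp only [sq, QuadraticAlgebra.re_mul, QuadraticAlgebra.im_mul, QuadraticAlgebra.re_one,
    QuadraticAlgebra.im_one, zero_mul, add_zero] at him hre
  norm_cast at him hre
  have h0 : a * b = 0 := by linarith
  have ha : a = 0 := (mul_eq_zero.1 h0).resolve_right hb
  subst ha
  nlinarith

theorem dvd_two_mul_relIndex_pellSubgroup_iff (hsq : ¬ IsSquare n) {a b : ℤ}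
    (hab : a ^ 2 - (n : ℤ) * b ^ 2 = 1) (hb : b ≠ 0) (d : ℕ) :
    d ∣ 2 * (pellSubgroup n a b hab).relIndex (normOneUnits n) ↔
      ∃ u ∈ normOneUnits n, u ^ d = pellUnit n a b hab ^ 2 := by
  obtain ⟨g, hg⟩ := exists_map_logEmb_eq_zpowers hsq
  have hneg : logEmb n (-1) = 1 := logEmb_eq_one_iff.2 (Or.inr rfl)
  rw [dvd_two_mul_relIndex_iff (logEmb n) hg (ε := pellUnit n a b hab)]
  · constructor
    · rintro ⟨u, hu, h⟩
      -- Equality of logarithms determines units only up to sign. With v > 0, both vᵈ and ε² are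
      -- positive, and the logarithm is injective there.
      obtain ⟨v, hv, hvpos, hvu⟩ : ∃ v ∈ normOneUnits n, 0 < realEmb n v ∧
          logEmb n v = logEmb n u := by
        rcases lt_or_gt_of_ne (realEmb_unit_ne_zero u) with h0 | h0
        · refine ⟨-1 * u, mul_mem (neg_one_mem_normOneUnits hsq) hu, ?_, ?_⟩
          · simpa using h0
          · rw [map_mul, hneg, one_mul]
        · exact ⟨u, hu, h0, rfl⟩
      refine ⟨v, hv, ?_⟩
      rw [← hvu, ← map_pow, ← map_pow] at h
      apply Units.ext
      apply realEmb_injective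
      refine Real.log_injOn_pos ?_ ?_ h
      · rw [Units.val_pow_eq_pow_val, map_pow]
        exact pow_pos hvpos d
      · rw [Units.val_pow_eq_pow_val, map_pow]
        exact even_two.pow_pos (realEmb_unit_ne_zero _)
    · rintro ⟨u, hu, h⟩
      exact ⟨u, hu, by rw [← map_pow, h, map_pow]⟩
  · rw [pellSubgroup, MonoidHom.map_closure, Set.image_pair, hneg, Subgroup.closure_insert_one,
      Subgroup.zpowers_eq_closure]
  · intro u hu
    rcases logEmb_eq_one_iff.1 hu with rfl | rfl
    · exact one_mem _
    · exact Subgroup.subset_closure (by simp)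
  · intro u hu
    rcases logEmb_eq_one_iff.1 hu with rfl | rfl
    · exact one_mem _
    · exact neg_one_mem_normOneUnits hsq
  · exact pellUnit_mem_normOneUnits hsq hab
  · intro h
    apply pell_sq_ne_one hab hb
    apply (toField_bijective hsq).1
    rw [map_pow, ← coe_pellUnit hab]
    rcases logEmb_eq_one_iff.1 h with h | h <;> rw [h] <;> simp

/-- A root of an algebraic integer is integral, and an element with a unit power is a unit; both
need d ≠ 0. -/
theorem exists_normOneUnit_pow_eq_iff (hsq : ¬ IsSquare n) {a b : ℤ}
    (hab : a ^ 2 - (n : ℤ) * b ^ 2 = 1) {d : ℕ} (hd : d ≠ 0) :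
    (∃ w : QuadraticAlgebra ℚ (n : ℚ) 0, w.norm = 1 ∧ w ^ d = ⟨a, b⟩ ^ 2) ↔
      ∃ u ∈ normOneUnits n, u ^ d = pellUnit n a b hab ^ 2 := by
  constructor
  · rintro ⟨w, hw, hwd⟩
    have hK : toField n w ^ d = ((pellUnit n a b hab ^ 2 : (𝓞 (QSqrt n))ˣ) : 𝓞 (QSqrt n)) := by
      rw [← map_pow, hwd, map_pow, ← coe_pellUnit hab, Units.val_pow_eq_pow_val]
      exact (map_pow (algebraMap (𝓞 (QSqrt n)) (QSqrt n)) _ _).symm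
    have hint : IsIntegral ℤ (toField n w) := by
      apply IsIntegral.of_pow (Nat.pos_of_ne_zero hd)
      rw [hK]
      exact NumberField.RingOfIntegers.isIntegral_coe _
    obtain ⟨v, hv⟩ : ∃ v : 𝓞 (QSqrt n), (v : QSqrt n) = toField n w := ⟨⟨_, hint⟩, rfl⟩
    have hvd : v ^ d = (pellUnit n a b hab ^ 2 : (𝓞 (QSqrt n))ˣ) := by
      apply NumberField.RingOfIntegers.ext
      rw [← hK, ← hv]
      exact map_pow (algebraMap (𝓞 (QSqrt n)) (QSqrt n)) _ _
    have hvu : IsUnit v := by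
      rw [← isUnit_pow_iff hd, hvd]
      exact Units.isUnit _
    obtain ⟨u, rfl⟩ := hvu
    refine ⟨u, ?_, Units.ext (by rw [← hvd, Units.val_pow_eq_pow_val])⟩
    change Algebra.norm ℚ ((u : 𝓞 (QSqrt n)) : QSqrt n) = 1
    rw [hv, norm_toField hsq, hw]
  · rintro ⟨u, hu, h⟩
    obtain ⟨z, hz⟩ := (toField_bijective hsq).2 (u : 𝓞 (QSqrt n))
    refine ⟨z, ?_, ?_⟩
    · rw [← norm_toField hsq, hz]; exact hu
    · apply (toField_bijective hsq).1
      rw [map_pow, map_pow, hz, ← coe_pellUnit hab, ← map_pow, ← map_pow,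
        ← Units.val_pow_eq_pow_val, ← Units.val_pow_eq_pow_val, h]

end

end ParametricPell

theorem theorem2 (n : ℕ) (hn : 0 < n) (hsq : ¬ IsSquare n) (a b : ℤ)
    (hab : a ^ 2 - (n : ℤ) * b ^ 2 = 1) (hb : b ≠ 0) (d : ℕ) :
    (∃ P Q D : Polynomial ℤ, IsParametricSolution n a b P Q D ∧ P.degree = d) ↔
      d ∣ 2 * (pellSubgroup n a b hab).relIndex (normOneUnits n) := by
  open ParametricPell in
  rw [exists_isParametricSolution_iff hsq hab hb,
    dvd_two_mul_relIndex_pellSubgroup_iff hsq hab hb,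
    exists_smul_pow_iff (sq_ne_natCast_of_not_isSquare hsq) (norm_pell hab)
      (pell_sq_ne_one hab hb)]
  -- For d = 0 both sides fail, the right one because u⁰ = 1 ≠ ε².
  rcases eq_or_ne d 0 with rfl | hd
  · simp only [ne_eq, not_true_eq_false, false_and, pow_zero, false_iff, not_exists, not_and]
    intro u _ h
    apply pell_sq_ne_one hab hb
    apply (toField_bijective hsq).1
    rw [map_pow, ← coe_pellUnit hab, ← map_pow, ← Units.val_pow_eq_pow_val, ← h]
    simp
  · rw [← exists_normOneUnit_pow_eq_iff hsq hab hd]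
    simp [hd]
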